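/- Let $h:\mathbb{R}^p\to\mathbb{R}\cup\{+\infty\}$ be lower semicontinuous with closed effective domain $\operatorname{dom} h\neq\emptyset$ and $\mu_h$-strongly convex for some $\mu_h\ge 0$ (merely convex if $\mu_h=0$). Let $g_1,\dots,g_n$ ($n\ge 1$) be real-valued functions on $\mathbb{R}^p$, convex on $\operatorname{dom} h$, differentiable on an open set containing $\operatorname{dom} h$ and twice differentiable on $\operatorname{dom} h$, such that for all $x,y\in\operatorname{dom} h$ $$\|\nabla g_i(x)-\nabla g_i(y)\|\le L_i\|x-y\|,\qquad \|\nabla^2 g_i(x)-\nabla^2 g_i(y)\|\le K_i\|x-y\|,$$ with $L_i,K_i>0$. Let $x^\star$ be any minimizer of $f=\frac1n\sum_{i=1}^n g_i+h$, and write $L_{max}=\max_i L_i$, $K_{avg}=\frac1n\sum_{i=1}^n K_i$. Consider PROXTONE started at $x^0\in\operatorname{dom} h$: put $\theta_{i,0}=0$ for all $i$; for $k=0,1,2,\dots$ let $$x^{k+1}\in\operatorname*{arg\,min}_{x\in\mathbb{R}^p}\Big\{\frac1n\sum_{i=1}^n\Big[g_i(x^{\theta_{i,k}})+(x-x^{\theta_{i,k}})^T\nabla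 g_i(x^{\theta_{i,k}})+\tfrac12(x-x^{\theta_{i,k}})^TH^i_k\,(x-x^{\theta_{i,k}})\Big]+h(x)\Big\},$$ then draw $j_k$ uniformly from $\{1,\dots,n\}$, independently of the earlier draws, and set $\theta_{j_k,k+1}=k+1$ and $\theta_{i,k+1}=\theta_{i,k}$ for $i\ne j_k$. Assume that the exact Hessians are used, $H^i_k=\nabla^2 g_i(x^{\theta_{i,k}})$, that these are positive definite, and that, almost surely, $L_iI\preceq mI\preceq H^i_k\preceq MI$ for all $i$ and all $k\ge0$. Then for every $k\ge0$, $\|x^{k+1}-x^\star\|$ is integrable and $$\mathbb{E}\,\|x^{k+1}-x^\star\|\le\Big(\frac{K_{avg}+2L_{max}}{m}\cdot\frac{M+L_{max}}{2\mu_h+m}+\frac{2L_{max}}{m}\Big)\Big[\frac1n\cdot\frac{M+L_{max}}{2\mu_h+m}+\Big(1-\frac1n\Big)\Big]^{k-1}\|x^\star-x^0\|^2 .$$ -/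

import Mathlib

open MeasureTheory ProbabilityTheory
open scoped ENNReal

namespace Proxtone

noncomputable section

/-- The space `ℝ^p` with its Euclidean norm. -/
abbrev Vec (p : ℕ) : Type := EuclideanSpace ℝ (Fin p)

/-- The Hessian `∇²f(x)`, as a linear operator: the derivative of the gradient. -/
def hessian {p : ℕ} (f : Vec p → ℝ) (x : Vec p) : Vec p →L[ℝ] Vec p :=
  fderiv ℝ (gradient f) x

/-- The effective domain of an extended-real-valued function. -/
def effDom {p : ℕ} (h : Vec p → EReal) : Set (Vec p) := {x | h x < ⊤}

/-- The composite objective `f(x) = (1/n) ∑ i, g i x + h x`. -/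
def objective {n p : ℕ} (g : Fin n → Vec p → ℝ) (h : Vec p → EReal) (x : Vec p) : EReal :=
  (((1 / (n : ℝ)) * ∑ i, g i x : ℝ) : EReal) + h x

/-- `lastUpdate j i k` is the random index `θ_{i,k}`: the iteration at which the model of the
`i`-th component function in use at iteration `k` was built. Here `j k` is the index sampled at
the end of iteration `k`, that is, once the `(k+1)`-st iterate is known. -/
def lastUpdate {n : ℕ} (j : ℕ → Fin n) (i : Fin n) : ℕ → ℕ
  | 0 => 0
  | k + 1 => if i = j k then k + 1 else lastUpdate j i k

/-- The quadratic model of `f` built at the point `y` with the matrix `A`, evaluated at `x`. -/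
def quadModel {p : ℕ} (f : Vec p → ℝ) (y : Vec p) (A : Vec p →L[ℝ] Vec p) (x : Vec p) : ℝ :=
  f y + inner ℝ (x - y) (gradient f y) + (1 / 2) * inner ℝ (x - y) (A (x - y))

/-- The averaged surrogate `G^k` along the iterates `x`, with sampled indices `j` and
matrices `H k i`. -/
def surrogate {n p : ℕ} (g : Fin n → Vec p → ℝ) (j : ℕ → Fin n) (x : ℕ → Vec p)
    (H : ℕ → Fin n → Vec p →L[ℝ] Vec p) (k : ℕ) (z : Vec p) : ℝ :=
  (1 / (n : ℝ)) * ∑ i, quadModel (g i) (x (lastUpdate j i k)) (H k i) z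

/-- `x` is the sequence of iterates of PROXTONE for the composite objective with smooth parts `g`
and regularizer `h`, started at `x₀`, when the sampled indices are `j` and the matrices held in
memory at iteration `k` are `H k i`. -/
structure IsRun {n p : ℕ} (g : Fin n → Vec p → ℝ) (h : Vec p → EReal) (x₀ : Vec p)
    (j : ℕ → Fin n) (H : ℕ → Fin n → Vec p →L[ℝ] Vec p) (x : ℕ → Vec p) : Prop where
  init : x 0 = x₀
  /-- The matrices are symmetric positive definite. -/
  posDef : ∀ k i, (H k i).IsSymmetric ∧ ∀ v, v ≠ 0 → 0 < inner ℝ v (H k i v)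
  /-- Only the matrix of the sampled component may change. -/
  keep : ∀ k i, i ≠ j k → H (k + 1) i = H k i
  /-- The next iterate minimizes the surrogate plus the regularizer over the whole space. -/
  step : ∀ k, IsMinOn (fun z => (surrogate g j x H k z : EReal) + h z) Set.univ (x (k + 1))

/-- The ratio `(M + L_max) / (2 μ_h + m)`. -/
def ratio (m M Lmax μ : ℝ) : ℝ := (M + Lmax) / (2 * μ + m)

/-- The rate `ρ = (1/n) (M + L_max) / (2 μ_h + m) + (1 - 1/n)`. -/
def rate (n : ℕ) (m M Lmax μ : ℝ) : ℝ :=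
  (1 / (n : ℝ)) * ratio m M Lmax μ + (1 - 1 / (n : ℝ))

/-- The constant `C = (K_avg + 2 L_max)/m * (M + L_max)/(2 μ_h + m) + 2 L_max / m`. -/
def const (m M Lmax Kavg μ : ℝ) : ℝ :=
  (Kavg + 2 * Lmax) / m * ratio m M Lmax μ + 2 * Lmax / m

end

end Proxtone

namespace Proxtone

/-! Write `e_i` for the error "quadratic model minus `g i`" at the stored point `y_i`. Strong
convexity of the objective at its minimizer `xstar` and of the surrogate at its minimizer `x (k +
1)` bounds `(m + 2μ)/2 * ‖x (k + 1) - xstar‖²` by the average of `e_i xstar - e_i (x (k + 1))`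
(`IsRun.growth`). This is used twice.

Since `L i ≤ m`, the models majorize, so `e_i (x (k + 1)) ≥ 0`, while `e_i xstar ≤ (M + L i)/2 *
‖xstar - y_i‖²`. Hence the new squared distance is at most `ratio` times the average stored one.
Each stored point is replaced with probability `1/n`, independently of the past, so expected stored
squared distances shrink by `rate` per iteration.

With exact Hessians the model's gradient error at `xstar` is quadratic in `‖xstar - y_i‖`, so the
difference of errors carries a factor `‖x (k + 1) - xstar‖`. Cancelling it bounds the distance
itself by stored squared distances. This gives the power `rate ^ k`; one factor `rate` is absorbed
into `const`. -/

/-! ### Taylor estimates and strong convexity. -/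

/-- First-order Taylor estimate on a convex set for a map whose derivative is Lipschitz at the
base point. -/
theorem norm_sub_sub_fderiv_le {E F : Type*} [NormedAddCommGroup E] [NormedSpace ℝ E]
    [NormedAddCommGroup F] [NormedSpace ℝ F] {s : Set E} (hs : Convex ℝ s) {f : E → F}
    {f' : E → E →L[ℝ] F} {c : ℝ} {x y : E} (hx : x ∈ s) (hy : y ∈ s)
    (hf : ∀ z ∈ s, HasFDerivAt f (f' z) z) (hc : ∀ z ∈ s, ‖f' z - f' y‖ ≤ c * ‖z - y‖) :
    ‖f x - f y - f' y (x - y)‖ ≤ c / 2 * ‖x - y‖ ^ 2 := by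
  have hmem : ∀ t ∈ Set.Icc (0 : ℝ) 1, y + t • (x - y) ∈ s := fun t ht =>
    hs.add_smul_sub_mem hy hx ht
  have hder : ∀ t ∈ Set.Icc (0 : ℝ) 1,
      HasDerivAt (fun t : ℝ => f (y + t • (x - y)) - f y - t • f' y (x - y))
        ((f' (y + t • (x - y)) - f' y) (x - y)) t := by
    intro t ht
    have hline : HasDerivAt (fun t : ℝ => y + t • (x - y)) (x - y) t := by
      simpa using ((hasDerivAt_id t).smul_const (x - y)).const_add y
    have h1 := (hf _ (hmem t ht)).comp_hasDerivAt t hline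
    have h2 : HasDerivAt (fun t : ℝ => t • f' y (x - y)) (f' y (x - y)) t := by
      simpa using (hasDerivAt_id t).smul_const (f' y (x - y))
    exact (h1.sub_const (f y)).sub h2
  have key := image_norm_le_of_norm_deriv_right_le_deriv_boundary (a := 0) (b := 1)
    (f := fun t : ℝ => f (y + t • (x - y)) - f y - t • f' y (x - y))
    (B := fun t => c / 2 * ‖x - y‖ ^ 2 * t ^ 2) (B' := fun t => c * ‖x - y‖ ^ 2 * t)
    (fun t ht => (hder t ht).continuousAt.continuousWithinAt)
    (fun t ht => (hder t ⟨ht.1, ht.2.le⟩).hasDerivWithinAt)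
    (by simp)
    (fun t => by
      refine ((hasDerivAt_pow 2 t).const_mul (c / 2 * ‖x - y‖ ^ 2)).congr_deriv ?_
      norm_num
      ring)
    (fun t ht => by
      refine ((f' (y + t • (x - y)) - f' y).le_opNorm _).trans ?_
      have h1 := hc _ (hmem t ⟨ht.1, ht.2.le⟩)
      rw [add_sub_cancel_left, norm_smul, Real.norm_of_nonneg ht.1] at h1
      calc _ ≤ c * (t * ‖x - y‖) * ‖x - y‖ := by gcongr
        _ = _ := by ring)
    (Set.right_mem_Icc.2 zero_le_one)
  simpa using key

/-- Quadratic growth of a strongly convex function away from its minimizer. -/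
theorem add_sq_le_of_isMinOn {E : Type*} [NormedAddCommGroup E] [NormedSpace ℝ E]
    {s : Set E} {f : E → ℝ} {c : ℝ} (hf : StrongConvexOn s c f) {x z : E} (hmin : IsMinOn f s x)
    (hx : x ∈ s) (hz : z ∈ s) : f x + c / 2 * ‖z - x‖ ^ 2 ≤ f z := by
  -- Compare `x` with the point `t • z + (1 - t) • x`, divide by `t`, then let `t` tend to `0`.
  have hlt : ∀ t ∈ Set.Ioo (0 : ℝ) 1, f x + (1 - t) * (c / 2 * ‖z - x‖ ^ 2) ≤ f z := by
    intro t ht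
    have h1 := hf.2 hz hx ht.1.le (sub_nonneg.2 ht.2.le) (by ring)
    have h2 := isMinOn_iff.1 hmin _
      (hf.1 hz hx ht.1.le (sub_nonneg.2 ht.2.le) (by ring))
    simp only [smul_eq_mul] at h1
    have h3 : t * (f x + (1 - t) * (c / 2 * ‖z - x‖ ^ 2)) ≤ t * f z := by nlinarith
    exact le_of_mul_le_mul_left h3 ht.1
  have hlim : Filter.Tendsto (fun t : ℝ => f x + (1 - t) * (c / 2 * ‖z - x‖ ^ 2))
      (nhdsWithin 0 (Set.Ioi 0)) (nhds (f x + (1 - 0) * (c / 2 * ‖z - x‖ ^ 2))) := by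
    apply Filter.Tendsto.mono_left _ nhdsWithin_le_nhds
    exact (Continuous.tendsto (by fun_prop) 0)
  have := le_of_tendsto hlim
    (Filter.mem_of_superset (Ioo_mem_nhdsGT (zero_lt_one' ℝ)) hlt)
  simpa using this

/-- The convexity gap of a quadratic form is exactly `a * b` times the form at `u - v`; symmetry of
`A` plays no role. -/
theorem strongConvexOn_quadModel {p : ℕ} {s : Set (Vec p)} (hs : Convex ℝ s) (f : Vec p → ℝ)
    (y : Vec p) {A : Vec p →L[ℝ] Vec p} {m : ℝ} (hA : ∀ v, m * ‖v‖ ^ 2 ≤ inner ℝ v (A v)) :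
    StrongConvexOn s m (quadModel f y A) := by
  refine ⟨hs, fun u _ v _ a b ha hb hab => ?_⟩
  have hw : a • u + b • v - y = a • (u - y) + b • (v - y) := by
    have : y = (a + b) • y := by rw [hab, one_smul]
    nth_rewrite 1 [this]
    module
  have huv : u - v = (u - y) - (v - y) := by abel
  have h1 := mul_le_mul_of_nonneg_left (hA (u - v)) (mul_nonneg ha hb)
  simp only [quadModel, smul_eq_mul, hw]
  rw [huv] at h1 ⊢
  generalize u - y = u' at *
  generalize v - y = v' at *
  simp only [map_sub, map_add, map_smul, inner_add_left, inner_add_right, inner_sub_left,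
    inner_sub_right, real_inner_smul_left, real_inner_smul_right] at h1 ⊢
  obtain rfl : b = 1 - a := by linarith
  nlinarith

theorem strongConvexOn_average {n : ℕ} (hn : 0 < n) {E : Type*} [NormedAddCommGroup E]
    [NormedSpace ℝ E] {s : Set E} {c : ℝ} {f : Fin n → E → ℝ} (hf : ∀ i, StrongConvexOn s c (f i)) :
    StrongConvexOn s c (fun z => (1 / (n : ℝ)) * ∑ i, f i z) := by
  refine ⟨(hf ⟨0, hn⟩).1, fun u hu v hv a b ha hb hab => ?_⟩
  have hn' : (n : ℝ) ≠ 0 := by positivity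
  have h1 := Finset.sum_le_sum fun i (_ : i ∈ Finset.univ) => (hf i).2 hu hv ha hb hab
  have h2 := mul_le_mul_of_nonneg_left h1 (by positivity : 0 ≤ 1 / (n : ℝ))
  refine h2.trans (le_of_eq ?_)
  simp only [smul_eq_mul, Finset.sum_sub_distrib, Finset.sum_add_distrib, ← Finset.mul_sum,
    Finset.sum_const, Finset.card_univ, Fintype.card_fin, nsmul_eq_mul]
  field_simp

theorem strongConvexOn_add {E : Type*} [NormedAddCommGroup E] [NormedSpace ℝ E] {s : Set E}
    {c d : ℝ} {f g : E → ℝ} (hf : StrongConvexOn s c f) (hg : StrongConvexOn s d g) :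
    StrongConvexOn s (c + d) (fun z => f z + g z) := by
  refine ⟨hf.1, fun u hu v hv a b ha hb hab => ?_⟩
  have h1 := hf.2 hu hv ha hb hab
  have h2 := hg.2 hu hv ha hb hab
  simp only [smul_eq_mul] at *
  nlinarith

/-- A minimizer of a finite function plus a proper extended-real-valued function lies in the
effective domain and minimizes the real-valued sum there. -/
theorem isMinOn_effDom {p : ℕ} {h : Vec p → EReal} (h_bot : ∀ x, h x ≠ ⊥)
    (hne : (effDom h).Nonempty) {f : Vec p → ℝ} {x : Vec p}
    (hmin : IsMinOn (fun z => (f z : EReal) + h z) Set.univ x) :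
    x ∈ effDom h ∧ IsMinOn (fun z => f z + (h z).toReal) (effDom h) x := by
  have hcoe : ∀ z ∈ effDom h, (f z : EReal) + h z = ((f z + (h z).toReal : ℝ) : EReal) := by
    intro z hz
    rw [EReal.coe_add, EReal.coe_toReal (ne_of_lt hz) (h_bot z)]
  have hx : x ∈ effDom h := by
    obtain ⟨z, hz⟩ := hne
    have h1 := isMinOn_iff.1 hmin z (Set.mem_univ z)
    rw [hcoe z hz] at h1
    by_contra hcon
    have htop : h x = ⊤ := not_lt_top_iff.1 hcon
    rw [htop, EReal.coe_add_top] at h1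
    exact absurd h1 (not_le.2 (EReal.coe_lt_top _))
  refine ⟨hx, isMinOn_iff.2 fun z hz => ?_⟩
  have h1 := isMinOn_iff.1 hmin z (Set.mem_univ z)
  rw [hcoe z hz, hcoe x hx] at h1
  exact_mod_cast h1

/-- The standing assumptions on the regularizer and on the smooth parts. -/
structure Regular {n p : ℕ} (g : Fin n → Vec p → ℝ) (h : Vec p → EReal) (L K : Fin n → ℝ)
    (μ : ℝ) : Prop where
  bot : ∀ x, h x ≠ ⊥
  strong : StrongConvexOn (effDom h) μ (fun x => (h x).toReal)
  conv : ∀ i, ConvexOn ℝ (effDom h) (g i)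
  diff : ∀ i, ∀ x ∈ effDom h, DifferentiableAt ℝ (g i) x
  diff2 : ∀ i, ∀ x ∈ effDom h, DifferentiableAt ℝ (gradient (g i)) x
  lip : ∀ i, ∀ x ∈ effDom h, ∀ y ∈ effDom h,
    ‖gradient (g i) x - gradient (g i) y‖ ≤ L i * ‖x - y‖
  hess_lip : ∀ i, ∀ x ∈ effDom h, ∀ y ∈ effDom h,
    ‖hessian (g i) x - hessian (g i) y‖ ≤ K i * ‖x - y‖

/-! ### Estimates along a single run. -/

section Deterministic

variable {n p : ℕ} {g : Fin n → Vec p → ℝ} {h : Vec p → EReal} {L K : Fin n → ℝ} {m M μ : ℝ}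

theorem Regular.abs_taylor_le (R : Regular g h L K μ) (i : Fin n) {x y : Vec p}
    (hx : x ∈ effDom h) (hy : y ∈ effDom h) :
    |g i x - g i y - inner ℝ (gradient (g i) y) (x - y)| ≤ L i / 2 * ‖x - y‖ ^ 2 := by
  have := norm_sub_sub_fderiv_le (f := g i)
    (f' := fun z => InnerProductSpace.toDual ℝ (Vec p) (gradient (g i) z)) (c := L i)
    R.strong.1 hx hy (fun z hz => (R.diff i z hz).hasGradientAt.hasFDerivAt)
    (fun z hz => by
      rw [← map_sub, LinearIsometryEquiv.norm_map]
      exact R.lip i z hz y hy)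
  simpa using this

theorem Regular.norm_gradient_taylor_le (R : Regular g h L K μ) (i : Fin n) {x y : Vec p}
    (hx : x ∈ effDom h) (hy : y ∈ effDom h) :
    ‖gradient (g i) x - gradient (g i) y - hessian (g i) y (x - y)‖ ≤ K i / 2 * ‖x - y‖ ^ 2 :=
  norm_sub_sub_fderiv_le (f := gradient (g i)) (f' := fun z => hessian (g i) z) (c := K i)
    R.strong.1 hx hy (fun z hz => (R.diff2 i z hz).hasFDerivAt)
    (fun z hz => R.hess_lip i z hz y hy)

/-- The curvature `m ≥ L i` of the model dominates the Taylor remainder of `g i`. -/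
theorem Regular.le_quadModel (R : Regular g h L K μ) (i : Fin n) (hLm : L i ≤ m) {x y : Vec p}
    {A : Vec p →L[ℝ] Vec p} (hA : ∀ v, m * ‖v‖ ^ 2 ≤ inner ℝ v (A v))
    (hx : x ∈ effDom h) (hy : y ∈ effDom h) : g i x ≤ quadModel (g i) y A x := by
  have h1 := (abs_le.1 (R.abs_taylor_le i hx hy)).2
  have h2 := hA (x - y)
  have h3 := mul_le_mul_of_nonneg_right hLm (sq_nonneg ‖x - y‖)
  rw [quadModel, real_inner_comm]
  linarith

theorem Regular.quadModel_le (R : Regular g h L K μ) (i : Fin n) {x y : Vec p}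
    {A : Vec p →L[ℝ] Vec p} (hA : ∀ v, inner ℝ v (A v) ≤ M * ‖v‖ ^ 2)
    (hx : x ∈ effDom h) (hy : y ∈ effDom h) :
    quadModel (g i) y A x ≤ g i x + (M + L i) / 2 * ‖x - y‖ ^ 2 := by
  have h1 := (abs_le.1 (R.abs_taylor_le i hx hy)).1
  have h2 := hA (x - y)
  rw [quadModel, real_inner_comm]
  linarith

/-- The model error `quadModel (g i) y A - g i` increases from `z` to `x` by at most the gradient
error at `x`, times the distance. -/
theorem Regular.quadModel_sub_le (R : Regular g h L K μ) (i : Fin n) (hLm : L i ≤ m)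
    {x y z : Vec p} (hA : ∀ v, m * ‖v‖ ^ 2 ≤ inner ℝ v (hessian (g i) y v))
    (hsym : (hessian (g i) y).IsSymmetric)
    (hx : x ∈ effDom h) (hy : y ∈ effDom h) (hz : z ∈ effDom h) :
    (quadModel (g i) y (hessian (g i) y) x - g i x)
      - (quadModel (g i) y (hessian (g i) y) z - g i z)
      ≤ K i / 2 * ‖x - y‖ ^ 2 * ‖z - x‖ := by
  -- Expand both functions about `x`. The linear terms differ by the gradient error paired with `z -
  -- x`; the second-order terms contribute at most `(L i - m)/2 * ‖z - x‖² ≤ 0`.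
  have h1 := (abs_le.1 (R.abs_taylor_le i hz hx)).2
  have h2 := hA (z - x)
  have h3 := mul_le_mul_of_nonneg_right hLm (sq_nonneg ‖z - x‖)
  have h4 : inner ℝ (gradient (g i) x - gradient (g i) y - hessian (g i) y (x - y)) (z - x)
      ≤ K i / 2 * ‖x - y‖ ^ 2 * ‖z - x‖ :=
    (real_inner_le_norm _ _).trans
      (mul_le_mul_of_nonneg_right (R.norm_gradient_taylor_le i hx hy) (norm_nonneg _))
  have hzy : z - y = (z - x) + (x - y) := by abel
  have h5 : inner ℝ (hessian (g i) y (x - y)) (z - x) =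
      inner ℝ (x - y) (hessian (g i) y (z - x)) := hsym _ _
  have h6 : inner ℝ (z - x) (hessian (g i) y (x - y)) =
      inner ℝ (x - y) (hessian (g i) y (z - x)) := by rw [← h5, real_inner_comm]
  simp only [quadModel, hzy, map_add, inner_add_left, inner_add_right]
  rw [inner_sub_left, inner_sub_left, h5] at h4
  have h7 := real_inner_comm (gradient (g i) y) (z - x)
  have h8 := real_inner_comm (gradient (g i) y) (x - y)
  linarith

variable {x₀ xstar : Vec p} {j : ℕ → Fin n} {H : ℕ → Fin n → Vec p →L[ℝ] Vec p} {x : ℕ → Vec p}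

theorem lastUpdate_le (j : ℕ → Fin n) (i : Fin n) (k : ℕ) : lastUpdate j i k ≤ k := by
  induction k with
  | zero => simp [lastUpdate]
  | succ k ih => rw [lastUpdate]; split_ifs <;> omega

theorem lastUpdate_congr {j j' : ℕ → Fin n} (i : Fin n) (k : ℕ) (hj : ∀ l < k, j l = j' l) :
    lastUpdate j i k = lastUpdate j' i k := by
  induction k with
  | zero => simp [lastUpdate]
  | succ k ih =>
    rw [lastUpdate, lastUpdate, hj k (by omega), ih fun l hl => hj l (by omega)]

theorem IsRun.mem_effDom (hr : IsRun g h x₀ j H x) (h_bot : ∀ x, h x ≠ ⊥) (hx₀ : x₀ ∈ effDom h)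
    (k : ℕ) : x k ∈ effDom h := by
  cases k with
  | zero => rw [hr.init]; exact hx₀
  | succ k => exact (isMinOn_effDom h_bot ⟨x₀, hx₀⟩ (hr.step k)).1

theorem strongConvexOn_surrogate_add (R : Regular g h L K μ) (hn : 0 < n)
    (hH : ∀ k i v, m * ‖v‖ ^ 2 ≤ inner ℝ v (H k i v)) (k : ℕ) :
    StrongConvexOn (effDom h) (m + μ) (fun z => surrogate g j x H k z + (h z).toReal) :=
  strongConvexOn_add (strongConvexOn_average hn fun i =>
    strongConvexOn_quadModel R.strong.1 (g i) _ (hH k i)) R.strong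

/-- Adding the two quadratic growth inequalities, with moduli `μ` for the objective and `m + μ` for
the surrogate, cancels `h` and leaves only model errors. -/
theorem IsRun.growth (hr : IsRun g h x₀ j H x) (R : Regular g h L K μ) (hn : 0 < n)
    (hx₀ : x₀ ∈ effDom h) (hstar : IsMinOn (objective g h) Set.univ xstar)
    (hH : ∀ k i v, m * ‖v‖ ^ 2 ≤ inner ℝ v (H k i v)) (k : ℕ) :
    (m + 2 * μ) / 2 * ‖x (k + 1) - xstar‖ ^ 2 ≤ (1 / (n : ℝ)) * ∑ i,
      ((quadModel (g i) (x (lastUpdate j i k)) (H k i) xstar - g i xstar) -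
        (quadModel (g i) (x (lastUpdate j i k)) (H k i) (x (k + 1)) - g i (x (k + 1)))) := by
  obtain ⟨hsD, hsmin⟩ := isMinOn_effDom R.bot ⟨x₀, hx₀⟩
    (f := fun z => (1 / (n : ℝ)) * ∑ i, g i z) hstar
  obtain ⟨hxD, hxmin⟩ := isMinOn_effDom R.bot ⟨x₀, hx₀⟩ (hr.step k)
  have hobj : StrongConvexOn (effDom h) (0 + μ)
      (fun z => (1 / (n : ℝ)) * ∑ i, g i z + (h z).toReal) :=
    strongConvexOn_add (strongConvexOn_average hn fun i => strongConvexOn_zero.2 (R.conv i)) R.strong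
  have h1 := add_sq_le_of_isMinOn hobj hsmin hsD hxD
  have h2 := add_sq_le_of_isMinOn (strongConvexOn_surrogate_add R hn hH k) hxmin hxD hsD
  rw [norm_sub_rev xstar] at h2
  simp only [surrogate] at h2
  simp only [Finset.sum_sub_distrib, mul_sub]
  linarith

theorem IsRun.sq_norm_sub_le (hr : IsRun g h x₀ j H x) (R : Regular g h L K μ) (hn : 0 < n)
    (hx₀ : x₀ ∈ effDom h) (hstar : IsMinOn (objective g h) Set.univ xstar)
    (hH : ∀ k i v, m * ‖v‖ ^ 2 ≤ inner ℝ v (H k i v))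
    (hHM : ∀ k i v, inner ℝ v (H k i v) ≤ M * ‖v‖ ^ 2) (hm : 0 < m) (hμ : 0 ≤ μ)
    (hLm : ∀ i, L i ≤ m) (k : ℕ) :
    ‖x (k + 1) - xstar‖ ^ 2 ≤ ratio m M (⨆ i, L i) μ *
      ((1 / (n : ℝ)) * ∑ i, ‖x (lastUpdate j i k) - xstar‖ ^ 2) := by
  have hsD := (isMinOn_effDom R.bot ⟨x₀, hx₀⟩
    (f := fun z => (1 / (n : ℝ)) * ∑ i, g i z) hstar).1
  have hxD := hr.mem_effDom R.bot hx₀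
  have h1 := hr.growth R hn hx₀ hstar hH k
  have h2 : ∀ i, (quadModel (g i) (x (lastUpdate j i k)) (H k i) xstar - g i xstar) -
        (quadModel (g i) (x (lastUpdate j i k)) (H k i) (x (k + 1)) - g i (x (k + 1))) ≤
      (M + ⨆ i, L i) / 2 * ‖x (lastUpdate j i k) - xstar‖ ^ 2 := by
    intro i
    have ha := R.le_quadModel i (hLm i) (hH k i) (hxD (k + 1)) (hxD (lastUpdate j i k))
    have hb := R.quadModel_le i (hHM k i) hsD (hxD (lastUpdate j i k))
    have hc : L i ≤ ⨆ i, L i := le_ciSup (Set.finite_range L).bddAbove i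
    have hd := mul_le_mul_of_nonneg_right hc (sq_nonneg ‖x (lastUpdate j i k) - xstar‖)
    rw [norm_sub_rev xstar] at hb
    linarith
  have h3 := mul_le_mul_of_nonneg_left (Finset.sum_le_sum fun i (_ : i ∈ Finset.univ) => h2 i)
    (by positivity : 0 ≤ 1 / (n : ℝ))
  rw [← Finset.mul_sum] at h3
  have hpos : 0 < 2 * μ + m := by positivity
  rw [ratio, div_mul_eq_mul_div, le_div_iff₀ hpos]
  linarith

/-- The bound from `Regular.quadModel_sub_le`, taken at `xstar`, is linear in the new distance,
whereas growth is quadratic in it; one factor cancels. -/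
theorem IsRun.norm_sub_le (hr : IsRun g h x₀ j H x) (R : Regular g h L K μ) (hn : 0 < n)
    (hx₀ : x₀ ∈ effDom h) (hstar : IsMinOn (objective g h) Set.univ xstar)
    (hexact : ∀ k i, H k i = hessian (g i) (x (lastUpdate j i k)))
    (hH : ∀ k i v, m * ‖v‖ ^ 2 ≤ inner ℝ v (H k i v)) (hm : 0 < m) (hμ : 0 ≤ μ)
    (hK : ∀ i, 0 ≤ K i) (hLm : ∀ i, L i ≤ m) (k : ℕ) :
    ‖x (k + 1) - xstar‖ ≤ 1 / (2 * μ + m) *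
      ((1 / (n : ℝ)) * ∑ i, K i * ‖x (lastUpdate j i k) - xstar‖ ^ 2) := by
  have hsD := (isMinOn_effDom R.bot ⟨x₀, hx₀⟩
    (f := fun z => (1 / (n : ℝ)) * ∑ i, g i z) hstar).1
  have hxD := hr.mem_effDom R.bot hx₀
  have h1 := hr.growth R hn hx₀ hstar hH k
  have h2 : ∀ i, (quadModel (g i) (x (lastUpdate j i k)) (H k i) xstar - g i xstar) -
        (quadModel (g i) (x (lastUpdate j i k)) (H k i) (x (k + 1)) - g i (x (k + 1))) ≤
      K i * ‖x (lastUpdate j i k) - xstar‖ ^ 2 * (‖x (k + 1) - xstar‖ / 2) := by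
    intro i
    have hA := hH k i
    have hsym := (hr.posDef k i).1
    rw [hexact k i] at hA hsym ⊢
    have := R.quadModel_sub_le i (hLm i) hA hsym hsD (hxD (lastUpdate j i k)) (hxD (k + 1))
    rw [norm_sub_rev xstar] at this
    linarith
  have h3 := mul_le_mul_of_nonneg_left (Finset.sum_le_sum fun i (_ : i ∈ Finset.univ) => h2 i)
    (by positivity : 0 ≤ 1 / (n : ℝ))
  rw [← Finset.sum_mul] at h3
  have hpos : 0 < 2 * μ + m := by positivity
  rw [one_div_mul_eq_div, le_div_iff₀ hpos]
  -- Cancelling the distance requires it to be nonzero.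
  rcases (norm_nonneg (x (k + 1) - xstar)).eq_or_lt with h0 | h0
  · rw [← h0, zero_mul]
    have : ∀ i, 0 ≤ K i * ‖x (lastUpdate j i k) - xstar‖ ^ 2 := fun i =>
      mul_nonneg (hK i) (sq_nonneg _)
    have := Finset.sum_nonneg fun i (_ : i ∈ Finset.univ) => this i
    positivity
  · refine le_of_mul_le_mul_right ?_ h0
    linarith

/-- The iterates up to time `k` are determined by the indices sampled before the last of them. -/
theorem IsRun.congr {j' : ℕ → Fin n} {H' : ℕ → Fin n → Vec p →L[ℝ] Vec p} {x' : ℕ → Vec p}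
    (hr : IsRun g h x₀ j H x) (hr' : IsRun g h x₀ j' H' x') (R : Regular g h L K μ) (hn : 0 < n)
    (hx₀ : x₀ ∈ effDom h) (hm : 0 < m) (hμ : 0 ≤ μ)
    (hexact : ∀ k i, H k i = hessian (g i) (x (lastUpdate j i k)))
    (hexact' : ∀ k i, H' k i = hessian (g i) (x' (lastUpdate j' i k)))
    (hH : ∀ k i v, m * ‖v‖ ^ 2 ≤ inner ℝ v (H k i v)) (k : ℕ) (hj : ∀ l < k, j l = j' l) :
    ∀ l ≤ k + 1, x l = x' l := by
  intro l
  induction l using Nat.strong_induction_on with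
  | _ l ih =>
    intro hl
    cases l with
    | zero => rw [hr.init, hr'.init]
    | succ l =>
      have hy : ∀ i, x (lastUpdate j i l) = x' (lastUpdate j' i l) := by
        intro i
        rw [lastUpdate_congr i l fun r hr => hj r (by omega)]
        have := lastUpdate_le j' i l
        exact ih _ (by omega) (by omega)
      have hs : surrogate g j' x' H' l = surrogate g j x H l := by
        funext z
        simp only [surrogate, hexact, hexact', hy]
      obtain ⟨h1D, h1⟩ := isMinOn_effDom R.bot ⟨x₀, hx₀⟩ (hr.step l)
      have hstep' := hr'.step l
      rw [hs] at hstep'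
      obtain ⟨h2D, h2⟩ := isMinOn_effDom R.bot ⟨x₀, hx₀⟩ hstep'
      -- The modulus `m + μ` is positive, so the argmin is unique and leaves no freedom of
      -- selection.
      exact ((strongConvexOn_surrogate_add R hn hH l).strictConvexOn
        (by positivity)).eq_of_isMinOn h1 h2 h1D h2D

end Deterministic

/-! ### Independence of the sampled index from the past. -/

section Sampling

variable {Ω : Type*} [MeasurableSpace Ω] {P : Measure Ω} {n : ℕ} {J : ℕ → Ω → Fin n}

/-- A function that is almost surely determined by the indices sampled before time `k`. -/
def AEDetermined (P : Measure Ω) (J : ℕ → Ω → Fin n) (k : ℕ) (B : Ω → ℝ) : Prop :=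
  ∃ φ : (Finset.range k → Fin n) → ℝ, B =ᵐ[P] fun ω => φ fun l => J l ω

/-- `B` need not be measurable: `φ` reads it off at any good outcome with the given finite index
history. -/
theorem aeDetermined_of_congr {k : ℕ} {B : Ω → ℝ} {G : Ω → Prop} (hG : ∀ᵐ ω ∂P, G ω)
    (hB : ∀ ω ω', G ω → G ω' → (∀ l < k, J l ω = J l ω') → B ω = B ω') :
    AEDetermined P J k B := by
  classical
  refine ⟨fun s => if hs : ∃ ω, G ω ∧ (fun l : Finset.range k => J l ω) = s
    then B hs.choose else 0, ?_⟩
  filter_upwards [hG] with ω hω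
  have hex : ∃ ω', G ω' ∧ (fun l : Finset.range k => J l ω') =
      fun l : Finset.range k => J l ω := ⟨ω, hω, rfl⟩
  rw [dif_pos hex]
  refine hB _ _ hω hex.choose_spec.1 fun l hl => ?_
  exact (congrFun hex.choose_spec.2 ⟨l, Finset.mem_range.2 hl⟩).symm

theorem AEDetermined.integrable [IsProbabilityMeasure P] (hJ : ∀ k, Measurable (J k)) {k : ℕ}
    {B : Ω → ℝ} (hB : AEDetermined P J k B) : Integrable B P := by
  obtain ⟨φ, hφ⟩ := hB
  have hmeas : Measurable fun ω => fun l : Finset.range k => J l ω :=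
    measurable_pi_lambda _ fun l => hJ l
  have : IsProbabilityMeasure (P.map fun ω => fun l : Finset.range k => J l ω) :=
    Measure.isProbabilityMeasure_map hmeas.aemeasurable
  exact ((Integrable.of_finite (f := φ)).comp_measurable hmeas).congr hφ.symm

/-- The index sampled at time `k` is independent of everything determined earlier. -/
theorem AEDetermined.integral_ite_mul [IsProbabilityMeasure P] (hJ : ∀ k, Measurable (J k))
    (hindep : iIndepFun J P) (hunif : ∀ k i, P (J k ⁻¹' {i}) = (n : ℝ≥0∞)⁻¹) {k : ℕ} {B : Ω → ℝ}
    (hB : AEDetermined P J k B) (i : Fin n) :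
    ∫ ω, (if i = J k ω then 1 else 0) * B ω ∂P = 1 / (n : ℝ) * ∫ ω, B ω ∂P := by
  have hint := hB.integrable hJ
  obtain ⟨φ, hφ⟩ := hB
  have hi := hindep.indepFun_finset {k} (Finset.range k) (by simp) hJ
  have hi' := hi.comp
    (φ := fun s : ({k} : Finset ℕ) → Fin n =>
      if i = s ⟨k, Finset.mem_singleton_self k⟩ then (1 : ℝ) else 0)
    (ψ := φ) (measurable_of_finite _) (measurable_of_finite _)
  have hc : Measurable fun ω => if i = J k ω then (1 : ℝ) else 0 :=
    (measurable_of_finite fun s : Fin n => if i = s then (1 : ℝ) else 0).comp (hJ k)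
  have hmeas : Measurable fun ω => fun l : Finset.range k => J l ω :=
    measurable_pi_lambda _ fun l => hJ l
  have hprod := hi'.integral_fun_mul_eq_mul_integral hc.aestronglyMeasurable
    ((measurable_of_finite φ).comp hmeas).aestronglyMeasurable
  have hone : ∫ ω, (if i = J k ω then (1 : ℝ) else 0) ∂P = 1 / (n : ℝ) := by
    have : (fun ω => if i = J k ω then (1 : ℝ) else 0) = (J k ⁻¹' {i}).indicator 1 := by
      funext ω
      by_cases hi : i = J k ω
      · rw [if_pos hi, Set.indicator_of_mem (show ω ∈ J k ⁻¹' {i} from hi.symm), Pi.one_apply]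
      · rw [if_neg hi, Set.indicator_of_notMem (fun h : ω ∈ J k ⁻¹' {i} => hi h.symm)]
    rw [this, integral_indicator_one (hJ k (measurableSet_singleton i)), Measure.real, hunif]
    simp
  rw [← hone, integral_congr_ae hφ]
  refine (integral_congr_ae ?_).trans hprod
  filter_upwards [hφ] with ω hω
  rw [hω]
  rfl

end Sampling

/-! ### Arithmetic of the constants. -/

theorem ratio_pos {m M l μ : ℝ} (hm : 0 < m) (hM : m ≤ M) (hl : 0 ≤ l) (hμ : 0 ≤ μ) :
    0 < ratio m M l μ := by
  have : 0 < M := hm.trans_le hM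
  unfold ratio
  positivity

theorem rate_pos {n : ℕ} (hn : 0 < n) {m M l μ : ℝ} (hm : 0 < m) (hM : m ≤ M) (hl : 0 ≤ l)
    (hμ : 0 ≤ μ) : 0 < rate n m M l μ := by
  have h1 := ratio_pos hm hM hl hμ
  have hn' : (0 : ℝ) < n := by exact_mod_cast hn
  have h2 : 1 / (n : ℝ) ≤ 1 := (div_le_one hn').2 (by exact_mod_cast hn)
  have h3 : 0 < 1 / (n : ℝ) * ratio m M l μ := by positivity
  unfold rate
  linarith

/-- `rate` is a convex combination of `ratio` and `1`. After division by `2μ + m`, both terms are at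
most `ratio / m`: the first because `μ ≥ 0`, the second because `m ≤ M + l`. -/
theorem mul_rate_le_const {n : ℕ} (hn : 0 < n) {m M l c μ : ℝ} (hm : 0 < m) (hM : m ≤ M)
    (hl : 0 ≤ l) (hc : 0 ≤ c) (hμ : 0 ≤ μ) :
    1 / (2 * μ + m) * c * rate n m M l μ ≤ const m M l c μ := by
  have hr := ratio_pos hm hM hl hμ
  have hn' : (0 : ℝ) < n := by exact_mod_cast hn
  have hu : 1 / (n : ℝ) ≤ 1 := (div_le_one hn').2 (by exact_mod_cast hn)
  have h1 : 1 / (2 * μ + m) ≤ 1 / m * ratio m M l μ := by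
    rw [ratio, div_mul_div_comm, one_mul, div_le_div_iff₀ (by positivity) (by positivity)]
    have : 0 < 2 * μ + m := by positivity
    nlinarith
  have h2 : 1 / (2 * μ + m) ≤ 1 / m := one_div_le_one_div_of_le hm (by linarith)
  have h3 : 1 / (2 * μ + m) * rate n m M l μ ≤ 1 / m * ratio m M l μ := by
    have h4 := mul_le_mul_of_nonneg_left (mul_le_mul_of_nonneg_right h2 hr.le)
      (by positivity : 0 ≤ 1 / (n : ℝ))
    have h5 := mul_le_mul_of_nonneg_left h1 (sub_nonneg.2 hu)
    unfold rate
    linarith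
  calc 1 / (2 * μ + m) * c * rate n m M l μ
      = c * (1 / (2 * μ + m) * rate n m M l μ) := by ring
    _ ≤ c * (1 / m * ratio m M l μ) := by gcongr
    _ ≤ c * (1 / m * ratio m M l μ) + (2 * l / m * ratio m M l μ + 2 * l / m) :=
        le_add_of_nonneg_right (by positivity)
    _ = const m M l c μ := by unfold const; ring

theorem inner_bounds {p : ℕ} {m M : ℝ} {A : Vec p →L[ℝ] Vec p}
    (hA : m • ContinuousLinearMap.id ℝ (Vec p) ≤ A ∧ A ≤ M • ContinuousLinearMap.id ℝ (Vec p))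
    (v : Vec p) : m * ‖v‖ ^ 2 ≤ inner ℝ v (A v) ∧ inner ℝ v (A v) ≤ M * ‖v‖ ^ 2 := by
  have h1 := hA.1.inner_nonneg_right v
  have h2 := hA.2.inner_nonneg_right v
  simp only [_root_.sub_apply, _root_.smul_apply,
    ContinuousLinearMap.id_apply, inner_sub_right, real_inner_smul_right,
    real_inner_self_eq_norm_sq] at h1 h2
  exact ⟨by linarith, by linarith⟩

/-! ### Bounds in expectation. -/

section Random

variable {n p : ℕ} {g : Fin n → Vec p → ℝ} {h : Vec p → EReal} {L K : Fin n → ℝ} {m M μ : ℝ}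
  {x₀ xstar : Vec p} {Ω : Type*} {J : ℕ → Ω → Fin n}
  {H : ℕ → Fin n → Ω → Vec p →L[ℝ] Vec p} {X : ℕ → Ω → Vec p}

/-- The outcome `ω` gives a PROXTONE run with exact Hessians obeying the spectral bounds. -/
structure GoodRun (g : Fin n → Vec p → ℝ) (h : Vec p → EReal) (m M : ℝ) (x₀ : Vec p)
    (J : ℕ → Ω → Fin n) (H : ℕ → Fin n → Ω → Vec p →L[ℝ] Vec p) (X : ℕ → Ω → Vec p) (ω : Ω) :
    Prop where
  run : IsRun g h x₀ (fun k => J k ω) (fun k i => H k i ω) (fun k => X k ω)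
  exact_hessian : ∀ k i, H k i ω = hessian (g i) (X (lastUpdate (fun l => J l ω) i k) ω)
  lower : ∀ k i v, m * ‖v‖ ^ 2 ≤ inner ℝ v (H k i ω v)
  upper : ∀ k i v, inner ℝ v (H k i ω v) ≤ M * ‖v‖ ^ 2

/-- The squared distance from the minimizer to the point at which the model of the `i`-th component
in use at iteration `k` was built. -/
noncomputable def sqDist (J : ℕ → Ω → Fin n) (X : ℕ → Ω → Vec p) (xstar : Vec p) (i : Fin n)
    (k : ℕ) (ω : Ω) : ℝ :=
  ‖X (lastUpdate (fun l => J l ω) i k) ω - xstar‖ ^ 2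

theorem GoodRun.congr (R : Regular g h L K μ) (hn : 0 < n) (hx₀ : x₀ ∈ effDom h) (hm : 0 < m)
    (hμ : 0 ≤ μ) {ω ω' : Ω} (hω : GoodRun g h m M x₀ J H X ω)
    (hω' : GoodRun g h m M x₀ J H X ω') {k : ℕ} (hj : ∀ l < k, J l ω = J l ω') :
    ∀ l ≤ k + 1, X l ω = X l ω' :=
  hω.run.congr hω'.run R hn hx₀ hm hμ hω.exact_hessian hω'.exact_hessian hω.lower k hj

variable [MeasurableSpace Ω] {P : Measure Ω}

theorem aeDetermined_norm_sub (R : Regular g h L K μ) (hn : 0 < n) (hx₀ : x₀ ∈ effDom h)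
    (hm : 0 < m) (hμ : 0 ≤ μ) (hgood : ∀ᵐ ω ∂P, GoodRun g h m M x₀ J H X ω) (k : ℕ) (r : ℕ) :
    AEDetermined P J k (fun ω => ‖X (k + 1) ω - xstar‖ ^ r) :=
  aeDetermined_of_congr hgood fun ω ω' hω hω' hj => by
    rw [hω.congr R hn hx₀ hm hμ hω' hj (k + 1) le_rfl]

theorem aeDetermined_sqDist (R : Regular g h L K μ) (hn : 0 < n) (hx₀ : x₀ ∈ effDom h)
    (hm : 0 < m) (hμ : 0 ≤ μ) (hgood : ∀ᵐ ω ∂P, GoodRun g h m M x₀ J H X ω) (i : Fin n) (k : ℕ) :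
    AEDetermined P J k (sqDist J X xstar i k) :=
  aeDetermined_of_congr hgood fun ω ω' hω hω' hj => by
    unfold sqDist
    rw [lastUpdate_congr i k hj, hω.congr R hn hx₀ hm hμ hω' hj _
      ((lastUpdate_le _ i k).trans k.le_succ)]

/-- The induction bounds every component `i` at once, because the new iterate is controlled by the
average over all of them. -/
theorem integral_sqDist_le [IsProbabilityMeasure P] (R : Regular g h L K μ) (hn : 0 < n)
    (hx₀ : x₀ ∈ effDom h) (hm : 0 < m) (hM : m ≤ M) (hμ : 0 ≤ μ) (hL : 0 ≤ ⨆ i, L i)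
    (hLm : ∀ i, L i ≤ m) (hstar : IsMinOn (objective g h) Set.univ xstar)
    (hJ : ∀ k, Measurable (J k)) (hindep : iIndepFun J P)
    (hunif : ∀ k i, P (J k ⁻¹' {i}) = (n : ℝ≥0∞)⁻¹)
    (hgood : ∀ᵐ ω ∂P, GoodRun g h m M x₀ J H X ω) (k : ℕ) (i : Fin n) :
    ∫ ω, sqDist J X xstar i k ω ∂P ≤ rate n m M (⨆ i, L i) μ ^ k * ‖xstar - x₀‖ ^ 2 := by
  induction k generalizing i with
  | zero =>
    have : sqDist J X xstar i 0 =ᵐ[P] fun _ => ‖xstar - x₀‖ ^ 2 := by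
      filter_upwards [hgood] with ω hω
      have : X 0 ω = x₀ := hω.run.init
      rw [sqDist, lastUpdate, this, norm_sub_rev]
    rw [integral_congr_ae this]
    simp
  | succ k ih =>
    set q := ratio m M (⨆ i, L i) μ with hq
    set D := rate n m M (⨆ i, L i) μ ^ k * ‖xstar - x₀‖ ^ 2 with hD
    have hn' : (0 : ℝ) < n := by exact_mod_cast hn
    have hu : 1 / (n : ℝ) ≤ 1 := (div_le_one hn').2 (by exact_mod_cast hn)
    have hq0 : 0 ≤ q := (ratio_pos hm hM hL hμ).le
    have hdy := fun i => aeDetermined_sqDist (xstar := xstar) R hn hx₀ hm hμ hgood i k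
    have hdx := aeDetermined_norm_sub (xstar := xstar) R hn hx₀ hm hμ hgood k 2
    have hb : ∫ ω, ‖X (k + 1) ω - xstar‖ ^ 2 ∂P ≤ q * D := by
      calc ∫ ω, ‖X (k + 1) ω - xstar‖ ^ 2 ∂P
          ≤ ∫ ω, q * ((1 / (n : ℝ)) * ∑ i, sqDist J X xstar i k ω) ∂P := by
            refine integral_mono_ae (hdx.integrable hJ)
              (((integrable_finsetSum _ fun i _ => (hdy i).integrable hJ).const_mul _).const_mul _)
              ?_
            filter_upwards [hgood] with ω hω
            exact hω.run.sq_norm_sub_le R hn hx₀ hstar hω.lower hω.upper hm hμ hLm k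
        _ = q * ((1 / (n : ℝ)) * ∑ i, ∫ ω, sqDist J X xstar i k ω ∂P) := by
            rw [integral_const_mul, integral_const_mul,
              integral_finsetSum _ fun i _ => (hdy i).integrable hJ]
        _ ≤ q * ((1 / (n : ℝ)) * ∑ _i : Fin n, D) := by
            gcongr with i
            exact ih i
        _ = q * D := by
            rw [Finset.sum_const, Finset.card_univ, Fintype.card_fin, nsmul_eq_mul]
            field_simp
    have hind : ∀ B : Ω → ℝ, Integrable B P →
        Integrable (fun ω => (if i = J k ω then (1 : ℝ) else 0) * B ω) P := by
      intro B hB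
      have hc : Measurable fun ω => if i = J k ω then (1 : ℝ) else 0 :=
        (measurable_of_finite fun s : Fin n => if i = s then (1 : ℝ) else 0).comp (hJ k)
      refine hB.bdd_mul (c := 1) hc.aestronglyMeasurable (Filter.Eventually.of_forall fun ω => ?_)
      split_ifs <;> simp
    -- Both `X (k + 1)` and the stored point depend only on indices drawn before time `k`, so the
    -- indicator of `i = J k` factors out of each expectation as `1/n`.
    have hsplit : ∀ ω, sqDist J X xstar i (k + 1) ω =
        (if i = J k ω then 1 else 0) * ‖X (k + 1) ω - xstar‖ ^ 2 +
          (sqDist J X xstar i k ω - (if i = J k ω then 1 else 0) * sqDist J X xstar i k ω) := by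
      intro ω
      rw [sqDist, lastUpdate]
      split_ifs <;> simp [sqDist]
    have hIx := hdx.integrable hJ
    have hIy := (hdy i).integrable hJ
    calc ∫ ω, sqDist J X xstar i (k + 1) ω ∂P
        = 1 / (n : ℝ) * ∫ ω, ‖X (k + 1) ω - xstar‖ ^ 2 ∂P +
            (1 - 1 / (n : ℝ)) * ∫ ω, sqDist J X xstar i k ω ∂P := by
          rw [integral_congr_ae (Filter.Eventually.of_forall hsplit),
            integral_add (hind _ hIx)
              (g := fun ω => sqDist J X xstar i k ω - (if i = J k ω then 1 else 0) *
                sqDist J X xstar i k ω) (hIy.sub (hind _ hIy)), integral_sub hIy (hind _ hIy),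
            hdx.integral_ite_mul hJ hindep hunif, (hdy i).integral_ite_mul hJ hindep hunif]
          ring
      _ ≤ 1 / (n : ℝ) * (q * D) + (1 - 1 / (n : ℝ)) * D := by
          have := sub_nonneg.2 hu
          gcongr
          exact ih i
      _ = rate n m M (⨆ i, L i) μ ^ (k + 1) * ‖xstar - x₀‖ ^ 2 := by
          have hrate : rate n m M (⨆ i, L i) μ = 1 / (n : ℝ) * q + (1 - 1 / (n : ℝ)) := rfl
          rw [pow_succ, mul_right_comm, ← hD, hrate]
          ring

theorem integral_norm_sub_le [IsProbabilityMeasure P] (R : Regular g h L K μ) (hn : 0 < n)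
    (hx₀ : x₀ ∈ effDom h) (hm : 0 < m) (hM : m ≤ M) (hμ : 0 ≤ μ) (hL : 0 ≤ ⨆ i, L i)
    (hK : ∀ i, 0 ≤ K i)
    (hLm : ∀ i, L i ≤ m) (hstar : IsMinOn (objective g h) Set.univ xstar)
    (hJ : ∀ k, Measurable (J k)) (hindep : iIndepFun J P)
    (hunif : ∀ k i, P (J k ⁻¹' {i}) = (n : ℝ≥0∞)⁻¹)
    (hgood : ∀ᵐ ω ∂P, GoodRun g h m M x₀ J H X ω) (k : ℕ) :
    Integrable (fun ω => ‖X (k + 1) ω - xstar‖) P ∧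
      ∫ ω, ‖X (k + 1) ω - xstar‖ ∂P ≤ 1 / (2 * μ + m) * ((1 / (n : ℝ)) * ∑ i, K i) *
        (rate n m M (⨆ i, L i) μ ^ k * ‖xstar - x₀‖ ^ 2) := by
  have hdy := fun i => aeDetermined_sqDist (xstar := xstar) R hn hx₀ hm hμ hgood i k
  have hdx := (aeDetermined_norm_sub (xstar := xstar) R hn hx₀ hm hμ hgood k 1).integrable hJ
  simp only [pow_one] at hdx
  refine ⟨hdx, ?_⟩
  calc ∫ ω, ‖X (k + 1) ω - xstar‖ ∂P
      ≤ ∫ ω, 1 / (2 * μ + m) * ((1 / (n : ℝ)) * ∑ i, K i * sqDist J X xstar i k ω) ∂P := by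
        refine integral_mono_ae hdx ((((integrable_finsetSum _ fun i _ =>
          ((hdy i).integrable hJ).const_mul _)).const_mul _).const_mul _) ?_
        filter_upwards [hgood] with ω hω
        exact hω.run.norm_sub_le R hn hx₀ hstar hω.exact_hessian hω.lower hm hμ hK hLm k
    _ = 1 / (2 * μ + m) * ((1 / (n : ℝ)) * ∑ i, K i * ∫ ω, sqDist J X xstar i k ω ∂P) := by
        rw [integral_const_mul, integral_const_mul,
          integral_finsetSum _ fun i _ => ((hdy i).integrable hJ).const_mul _]
        simp_rw [integral_const_mul]
    _ ≤ 1 / (2 * μ + m) * ((1 / (n : ℝ)) * ∑ i, K i *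
          (rate n m M (⨆ i, L i) μ ^ k * ‖xstar - x₀‖ ^ 2)) := by
        gcongr with i
        · exact hK i
        · exact integral_sqDist_le R hn hx₀ hm hM hμ hL hLm hstar hJ hindep hunif hgood k i
    _ = _ := by rw [← Finset.sum_mul]; ring

end Random

end Proxtone

theorem theorem2 {n p : ℕ} (hn : 0 < n)
    -- the component functions
    (g : Fin n → Proxtone.Vec p → ℝ) (h : Proxtone.Vec p → EReal)
    (L K : Fin n → ℝ) (m M μ : ℝ)
    -- the regularizer: proper, lower semicontinuous, closed domain, strongly convex
    (h_bot : ∀ x, h x ≠ ⊥)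
    (h_lsc : LowerSemicontinuous h)
    (h_closed : IsClosed (Proxtone.effDom h))
    (hμ : 0 ≤ μ)
    (h_conv : StrongConvexOn (Proxtone.effDom h) μ (fun x => (h x).toReal))
    -- the smooth parts: convex, (twice) differentiable, Lipschitz gradients and Hessians
    (g_conv : ∀ i, ConvexOn ℝ (Proxtone.effDom h) (g i))
    (U : Set (Proxtone.Vec p)) (hU : IsOpen U) (hdomU : Proxtone.effDom h ⊆ U)
    (g_diff : ∀ i, DifferentiableOn ℝ (g i) U)
    (g_diff2 : ∀ i, ∀ x ∈ Proxtone.effDom h, DifferentiableAt ℝ (gradient (g i)) x)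
    (hL : ∀ i, 0 < L i)
    (g_lip : ∀ i, ∀ x ∈ Proxtone.effDom h, ∀ y ∈ Proxtone.effDom h,
      ‖gradient (g i) x - gradient (g i) y‖ ≤ L i * ‖x - y‖)
    (hK : ∀ i, 0 < K i)
    (hess_lip : ∀ i, ∀ x ∈ Proxtone.effDom h, ∀ y ∈ Proxtone.effDom h,
      ‖Proxtone.hessian (g i) x - Proxtone.hessian (g i) y‖ ≤ K i * ‖x - y‖)
    -- a minimizer, and the starting point
    (xstar : Proxtone.Vec p)
    (hstar : IsMinOn (Proxtone.objective g h) Set.univ xstar)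
    (x₀ : Proxtone.Vec p) (hx₀ : x₀ ∈ Proxtone.effDom h)
    -- independent uniform sampling
    {Ω : Type*} [MeasurableSpace Ω] (P : Measure Ω) [IsProbabilityMeasure P]
    (J : ℕ → Ω → Fin n) (hJ_meas : ∀ k, Measurable (J k))
    (hJ_indep : iIndepFun J P)
    (hJ_unif : ∀ k i, P (J k ⁻¹' {i}) = (n : ℝ≥0∞)⁻¹)
    -- the PROXTONE iterates, with exact Hessians
    (H : ℕ → Fin n → Ω → Proxtone.Vec p →L[ℝ] Proxtone.Vec p)
    (X : ℕ → Ω → Proxtone.Vec p)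
    (hrun : ∀ᵐ ω ∂P, Proxtone.IsRun g h x₀ (fun k => J k ω) (fun k i => H k i ω)
      (fun k => X k ω))
    (hexact : ∀ᵐ ω ∂P, ∀ k i, H k i ω =
      Proxtone.hessian (g i) (X (Proxtone.lastUpdate (fun l => J l ω) i k) ω))
    -- the spectral bounds `L_i I ⪯ m I ⪯ H ⪯ M I`
    (hLm : ∀ i, L i ≤ m)
    (hH_bounds : ∀ᵐ ω ∂P, ∀ k i,
      m • ContinuousLinearMap.id ℝ (Proxtone.Vec p) ≤ H k i ω ∧
        H k i ω ≤ M • ContinuousLinearMap.id ℝ (Proxtone.Vec p))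
    (k : ℕ) :
    Integrable (fun ω => ‖X (k + 1) ω - xstar‖) P ∧
      ∫ ω, ‖X (k + 1) ω - xstar‖ ∂P ≤
        Proxtone.const m M (⨆ i, L i) ((1 / (n : ℝ)) * ∑ i, K i) μ
          * Proxtone.rate n m M (⨆ i, L i) μ ^ ((k : ℤ) - 1) * ‖xstar - x₀‖ ^ 2 := by
  have hmpos : 0 < m := (hL ⟨0, hn⟩).trans_le (hLm ⟨0, hn⟩)
  have hgood : ∀ᵐ ω ∂P, Proxtone.GoodRun g h m M x₀ J H X ω := by
    filter_upwards [hrun, hexact, hH_bounds] with ω h1 h2 h3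
    exact ⟨h1, h2, fun k i v => (Proxtone.inner_bounds (h3 k i) v).1,
      fun k i v => (Proxtone.inner_bounds (h3 k i) v).2⟩
  -- In dimension zero the spectral bounds do not force `m ≤ M`, but all distances vanish.
  rcases subsingleton_or_nontrivial (Proxtone.Vec p) with hsub | hnt
  · have hX : ∀ ω, ‖X (k + 1) ω - xstar‖ = 0 := fun ω => by
      rw [Subsingleton.elim (X (k + 1) ω) xstar, sub_self, norm_zero]
    simp only [hX, integral_zero]
    simp [Subsingleton.elim xstar x₀]
  · have hM : m ≤ M := by
      obtain ⟨ω, hω⟩ := hgood.exists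
      obtain ⟨v, hv⟩ := exists_ne (0 : Proxtone.Vec p)
      have h1 := (hω.lower 0 ⟨0, hn⟩ v).trans (hω.upper 0 ⟨0, hn⟩ v)
      exact le_of_mul_le_mul_right h1 (by positivity)
    have R : Proxtone.Regular g h L K μ := ⟨h_bot, h_conv, g_conv,
      fun i x hx => (g_diff i).differentiableAt (hU.mem_nhds (hdomU hx)), g_diff2, g_lip, hess_lip⟩
    have hLmax : 0 ≤ ⨆ i, L i :=
      (hL ⟨0, hn⟩).le.trans (le_ciSup (Set.finite_range L).bddAbove ⟨0, hn⟩)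
    obtain ⟨hint, hle⟩ := Proxtone.integral_norm_sub_le R hn hx₀ hmpos hM hμ hLmax
      (fun i => (hK i).le) hLm hstar hJ_meas hJ_indep hJ_unif hgood k
    refine ⟨hint, hle.trans ?_⟩
    have hrate := Proxtone.rate_pos hn hmpos hM hLmax hμ
    have hKavg : 0 ≤ 1 / (n : ℝ) * ∑ i, K i :=
      mul_nonneg (by positivity) (Finset.sum_nonneg fun i _ => (hK i).le)
    have hconst := Proxtone.mul_rate_le_const hn hmpos hM hLmax hKavg hμ
    rw [← mul_assoc]
    refine mul_le_mul_of_nonneg_right ?_ (sq_nonneg _)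
    -- The exponent is an integer, equal to `-1` at `k = 0`; splitting off one factor needs `rate ≠
    -- 0`.
    have hpow : Proxtone.rate n m M (⨆ i, L i) μ ^ k =
        Proxtone.rate n m M (⨆ i, L i) μ *
          Proxtone.rate n m M (⨆ i, L i) μ ^ ((k : ℤ) - 1) := by
      rw [zpow_sub_one₀ hrate.ne', zpow_natCast]
      field_simp
    rw [hpow, ← mul_assoc]
    exact mul_le_mul_of_nonneg_right hconst (zpow_pos hrate _).le
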